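/- Let $k \ge 1$ and $n \ge k+1$. An instance of $k$-Facility Location on the line is a pair $(\vec x, c)$ with $\vec x = (x_1,\dots,x_n) \in \mathbb R^n$ the agents' locations and $c : \mathbb R_{\ge 0} \to \mathbb R_{\ge 0}$ a cost function with $c(0)=0$; throughout, $c$ is concave and continuous. For facilities $\vec y \in \mathbb R^k$, an agent at $a$ has cost $\mathrm{cost}(a,\vec y) = c(\min_{1\le j\le k}|a-y_j|)$; for a probability distribution $P$ over $\mathbb R^k$, $\mathrm{cost}(a,P) = \mathbb E_{\vec y\sim P}[\mathrm{cost}(a,\vec y)]$. Put $MC^*(\vec x,c)=\min_{\vec y\in\mathbb R^k}\max_i \mathrm{cost}(x_i,\vec y)$ and $SC^*(\vec x,c)=\min_{\vec y\in\mathbb R^k}\sum_i \mathrm{cost}(x_i,\vec y)$. A randomized mechanism maps each instance to a probability distribution over $\mathbb R^k$. The Equal Cost mechanism $EC$ proceeds on $(\vec x,c)$ as follows. 1. It takes a covering of all agent locations by $k$ pairwise disjoint intervals $[\alpha_j,\alpha_j+\ell]$, $\alpha_1<\dots<\alpha_k$, of minimum length $\ell\ge 0$. 2. It takes a random variable $X$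 with values in $[0,\ell]$ such that $\mathbb E[c(|a-X|)]$ is the same for all $a\in[0,\ell]$. 3. It places, with the same $X$ for all intervals, a facility at $\alpha_j+X$ for each odd $j$ and at $\alpha_j+\ell-X$ for each even $j$. Then the mechanism can be carried out on every such instance (a covering of minimum length $\ell$ and a random variable $X$ as required always exist), and, for every choice of the coverings and of the random variables $X$, the following hold. - $EC$ is group strategyproof: for every $c$, every profile $\vec x$, every non-empty coalition $S$ and every profile $\vec x'$ with $x'_i=x_i$ for all $i\notin S$, there is $i\in S$ with $\mathrm{cost}(x_i,EC(\vec x,c))\le \mathrm{cost}(x_i,EC(\vec x',c))$. - $EC$ is $2$-approximate for Max Cost: $\mathbb E_{\vec y\sim EC(\vec x,c)}[\max_i \mathrm{cost}(x_i,\vec y)]\le 2\,MC^*(\vec x,c)$ for all $(\vec x,c)$. - $EC$ is $n$-approximate for Social Cost: $\sum_i \mathrm{cost}(x_i,EC(\vec x,c))\le n\,SC^*(\vec x,c)$ for all $(\vec x,c)$. - For every instance $(\vec x,c)$ and every agent $i$, $\mathrm{cost}(x_i,EC(\vec x,c))\le MC^*(\vec x,c)=c(\ell/2)$. -/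

import Mathlib

open MeasureTheory Set

noncomputable section

namespace FacilityLocation

/-- A cost function is represented by a map `ℝ → ℝ` of which only the values at distances `d ≥ 0`
are ever used. It is non-negative there, normalized by `c 0 = 0`, concave and continuous
(for concave functions this only excludes a jump at `0`). -/
structure IsConcaveCost (c : ℝ → ℝ) : Prop where
  map_zero : c 0 = 0
  nonneg : ∀ d, 0 ≤ d → 0 ≤ c d
  concave : ConcaveOn ℝ (Ici 0) c
  continuous : ContinuousOn c (Ici 0)

/-- The class of all (continuous) concave cost functions. -/
def concaveCosts : Set (ℝ → ℝ) := {c | IsConcaveCost c}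

/-- A randomized mechanism maps an instance `(x, c)` with `n` agents to a probability distribution
over `k`-tuples of facility locations. -/
abbrev Mechanism (k n : ℕ) : Type :=
  (Fin n → ℝ) → (ℝ → ℝ) → ProbabilityMeasure (Fin k → ℝ)

variable {k n : ℕ}

/-- Connection cost `c (min_j |a - y_j|)` of an agent at `a` for the facilities `y`. -/
def cost (c : ℝ → ℝ) (a : ℝ) (y : Fin k → ℝ) : ℝ := c (⨅ j, |a - y j|)

/-- Expected connection cost of an agent at `a` for random facilities. -/
def expCost (c : ℝ → ℝ) (a : ℝ) (P : ProbabilityMeasure (Fin k → ℝ)) : ℝ :=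
  ∫ y, cost c a y ∂(P : Measure (Fin k → ℝ))

/-- Maximum connection cost of the agents for the facilities `y`. -/
def maxCost (c : ℝ → ℝ) (x : Fin n → ℝ) (y : Fin k → ℝ) : ℝ := ⨆ i, cost c (x i) y

/-- Expected maximum cost. -/
def expMaxCost (c : ℝ → ℝ) (x : Fin n → ℝ) (P : ProbabilityMeasure (Fin k → ℝ)) : ℝ :=
  ∫ y, maxCost c x y ∂(P : Measure (Fin k → ℝ))

/-- Optimal maximum cost with `k` facilities. -/
def optMaxCost (k : ℕ) (c : ℝ → ℝ) (x : Fin n → ℝ) : ℝ := ⨅ y : Fin k → ℝ, maxCost c x y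

/-- Expected social cost. -/
def expSocialCost (c : ℝ → ℝ) (x : Fin n → ℝ) (P : ProbabilityMeasure (Fin k → ℝ)) : ℝ :=
  ∑ i, expCost c (x i) P

/-- Optimal social cost with `k` facilities. -/
def optSocialCost (k : ℕ) (c : ℝ → ℝ) (x : Fin n → ℝ) : ℝ :=
  ⨅ y : Fin k → ℝ, ∑ i, cost c (x i) y

/-- Approximation ratio `ρ` for the maximum cost, on a class `C` of cost functions. -/
def HasMaxCostRatio (C : Set (ℝ → ℝ)) (F : Mechanism k n) (ρ : ℝ) : Prop :=
  ∀ c ∈ C, ∀ x : Fin n → ℝ, expMaxCost c x (F x c) ≤ ρ * optMaxCost k c x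

/-- Approximation ratio `ρ` for the social cost, on a class `C` of cost functions. -/
def HasSocialCostRatio (C : Set (ℝ → ℝ)) (F : Mechanism k n) (ρ : ℝ) : Prop :=
  ∀ c ∈ C, ∀ x : Fin n → ℝ, expSocialCost c x (F x c) ≤ ρ * optSocialCost k c x

/-- (Weak) group strategyproofness: whenever the agents of a non-empty coalition `S` change their
reports, turning the true profile `x` into `x'`, some agent of `S` does not benefit. -/
def GroupStrategyproof (C : Set (ℝ → ℝ)) (F : Mechanism k n) : Prop :=
  ∀ c ∈ C, ∀ x : Fin n → ℝ, ∀ S : Finset (Fin n), S.Nonempty →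
    ∀ x' : Fin n → ℝ, (∀ i, i ∉ S → x' i = x i) →
      ∃ i ∈ S, expCost c (x i) (F x c) ≤ expCost c (x i) (F x' c)

/-- The intervals `[α j, α j + ℓ]`, numbered from left to right, are pairwise disjoint and cover
all agent locations. -/
structure IsCovering (x : Fin n → ℝ) (ℓ : ℝ) (α : Fin k → ℝ) : Prop where
  length_nonneg : 0 ≤ ℓ
  strictMono : StrictMono α
  disjoint : Pairwise fun i j => Disjoint (Icc (α i) (α i + ℓ)) (Icc (α j) (α j + ℓ))
  covers : ∀ i, ∃ j, x i ∈ Icc (α j) (α j + ℓ)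

/-- `ℓ` is the minimum length for which `k` disjoint intervals of length `ℓ` cover the agents. -/
def IsMinLength (k : ℕ) (x : Fin n → ℝ) (ℓ : ℝ) : Prop :=
  IsLeast {l : ℝ | ∃ α : Fin k → ℝ, IsCovering x l α} ℓ

/-- `μ` is the law of a random variable `X` with values in `[0, ℓ]` for which all locations
`a ∈ [0, ℓ]` have the same expected connection cost `E[c(|a - X|)]`. -/
structure IsEqualizing (c : ℝ → ℝ) (ℓ : ℝ) (μ : ProbabilityMeasure ℝ) : Prop where
  support : (μ : Measure ℝ) (Icc 0 ℓ)ᶜ = 0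
  equal : ∀ a ∈ Icc 0 ℓ, ∀ b ∈ Icc 0 ℓ,
    ∫ t, c |a - t| ∂(μ : Measure ℝ) = ∫ t, c |b - t| ∂(μ : Measure ℝ)

/-- The facilities for the sample `t` of `X`: at `α j + t` in the 1st, 3rd, 5th, ... interval and,
reflected, at `α j + ℓ - t` in the 2nd, 4th, ... interval (`Fin k` counts from `0`). -/
def placement (ℓ : ℝ) (α : Fin k → ℝ) (t : ℝ) : Fin k → ℝ :=
  fun j => if Even (j : ℕ) then α j + t else α j + ℓ - t

/-- `F` is an Equal Cost mechanism: on every instance with a concave cost function it takes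
an optimal covering, an equalizing random variable `X`, and outputs the facilities placed
according to `X` with reflection in every other interval. -/
def IsEqualCost (F : Mechanism k n) : Prop :=
  ∀ c ∈ concaveCosts, ∀ x : Fin n → ℝ,
    ∃ (ℓ : ℝ) (α : Fin k → ℝ) (μ : ProbabilityMeasure ℝ),
      IsMinLength k x ℓ ∧ IsCovering x ℓ α ∧ IsEqualizing c ℓ μ ∧
        (F x c : Measure (Fin k → ℝ)) = (μ : Measure ℝ).map (placement ℓ α)

end FacilityLocation

end

noncomputable section

namespace FacilityLocation

namespace IsConcaveCost

variable {c : ℝ → ℝ}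

/-! Everything is reduced to one facility on one interval: `potential c μ s` is the expected cost at
`s` of a facility with law `μ`.

An equalizing law exists by an energy argument. On the compact interval `[0, ℓ]`, a probability
measure maximizing `∬ c |s - t|` has potential at most its energy `E` everywhere and equal to `E`
almost everywhere (`exists_potential_le_and_ae_eq`). Concavity of `c` spreads the value `E` over the
gaps of the set where it is attained, and monotonicity over the two ends.

Reflecting every other facility makes the index of the nearest facility independent of the sample
(`exists_nearest`). An agent therefore pays the potential at its folded coordinate, and a covered
agent pays the common value on `[0, ℓ]`, which is at most `c (ℓ / 2)`, the optimal maximum cost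
(`optMaxCost_eq`). This bounds each agent's cost and hence the social cost; for the expected maximum
cost, all distances are at most `ℓ` and `c ℓ ≤ 2 * c (ℓ / 2)`.

For group strategyproofness, suppose that a whole coalition gains. Then the folded coordinates of
all true locations, with respect to the misreported covering, together with `[0, ℓ']` span an
interval `[lo, hi]` whose end points are strictly cheaper than the truthful cost. Unfolding `[lo,
hi]` covers the true profile, so `ℓ ≤ hi - lo`. Averaging the distance cost over both equalizing
laws and applying Fubini (`IsEqualizing.potential_zero_le_max`) contradicts this. -/

theorem monotoneOn (hc : IsConcaveCost c) : MonotoneOn c (Ici 0) := by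
  intro x hx y hy hxy
  by_contra! hlt
  have hne : x < y := lt_of_le_of_ne hxy (by rintro rfl; exact lt_irrefl _ hlt)
  rw [mem_Ici] at hx hy
  have hm : 0 < c x - c y := by linarith
  -- If `c` decreased from `x` to `y`, the chord through these points would reach the value `-1` at
  -- `z`; concavity keeps `c z` below it.
  set z := y + (c y + 1) * (y - x) / (c x - c y) with hz
  have hyz : y < z := by
    have : 0 < (c y + 1) * (y - x) / (c x - c y) :=
      div_pos (mul_pos (by linarith [hc.nonneg y hy]) (by linarith)) hm
    linarith
  have hz0 : 0 ≤ z := by linarith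
  have h := hc.concave.slope_anti_adjacent (mem_Ici.2 hx) (mem_Ici.2 hz0) hne hyz
  rw [div_le_div_iff₀ (by linarith) (by linarith)] at h
  have h2 : (c y - c x) * (z - y) = -((c y + 1) * (y - x)) := by
    rw [hz]; field_simp; ring
  rw [h2] at h
  have h3 : c z - c y ≤ -(c y + 1) := by
    have : (c z - c y) * (y - x) ≤ (-(c y + 1)) * (y - x) := by linarith
    exact le_of_mul_le_mul_right this (by linarith)
  linarith [hc.nonneg z hz0]

theorem mono (hc : IsConcaveCost c) {a b : ℝ} (ha : 0 ≤ a) (hab : a ≤ b) : c a ≤ c b :=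
  hc.monotoneOn ha (ha.trans hab) hab

theorem continuous_comp_abs (hc : IsConcaveCost c) : Continuous fun t => c |t| :=
  hc.continuous.comp_continuous continuous_abs fun t => abs_nonneg t

theorem continuous_kernel (hc : IsConcaveCost c) :
    Continuous fun p : ℝ × ℝ => c |p.1 - p.2| :=
  hc.continuous_comp_abs.comp (continuous_fst.sub continuous_snd)

theorem continuous_abs_sub (hc : IsConcaveCost c) (s : ℝ) : Continuous fun t => c |s - t| :=
  hc.continuous_comp_abs.comp (continuous_const.sub continuous_id)

theorem le_two_mul_half (hc : IsConcaveCost c) {d : ℝ} (hd : 0 ≤ d) : c d ≤ 2 * c (d / 2) := by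
  have h := hc.concave.2 (mem_Ici.2 le_rfl) (mem_Ici.2 hd) (show (0 : ℝ) ≤ 1 / 2 by norm_num)
    (show (0 : ℝ) ≤ 1 / 2 by norm_num) (by norm_num)
  simp only [smul_eq_mul, hc.map_zero, mul_zero, zero_add] at h
  rw [show 1 / 2 * d = d / 2 by ring] at h
  linarith

end IsConcaveCost

/-- The expected cost of an agent at `s` served by a single random facility with law `μ`. -/
def potential (c : ℝ → ℝ) (μ : Measure ℝ) (s : ℝ) : ℝ := ∫ t, c |s - t| ∂μ

/-! ### Potentials of laws supported on an interval -/

section Potential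

variable {c : ℝ → ℝ} {μ : Measure ℝ} {ℓ : ℝ}

theorem integrable_of_compl_Icc_null [IsFiniteMeasure μ] (hμ : μ (Icc 0 ℓ)ᶜ = 0) {f : ℝ → ℝ}
    (hf : Continuous f) : Integrable f μ := by
  rw [← Measure.restrict_eq_self_of_ae_mem (μ := μ) (s := Icc 0 ℓ) hμ]
  exact hf.continuousOn.integrableOn_compact isCompact_Icc

theorem continuous_potential [IsFiniteMeasure μ] (hc : IsConcaveCost c)
    (hμ : μ (Icc 0 ℓ)ᶜ = 0) : Continuous (potential c μ) := by
  have h := continuous_parametric_integral_of_continuous (μ := μ)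
    (f := fun s t : ℝ => c |s - t|) hc.continuous_kernel (isCompact_Icc (a := (0 : ℝ)) (b := ℓ))
  rwa [Measure.restrict_eq_self_of_ae_mem (μ := μ) (s := Icc 0 ℓ) hμ] at h

theorem potential_anti_left [IsFiniteMeasure μ] (hc : IsConcaveCost c)
    (hμ : μ (Icc 0 ℓ)ᶜ = 0) {v s s' : ℝ} (hv : μ (Iio v) = 0) (hss : s ≤ s') (hs : s' ≤ v) :
    potential c μ s' ≤ potential c μ s := by
  refine integral_mono_ae (integrable_of_compl_Icc_null hμ (hc.continuous_abs_sub _))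
    (integrable_of_compl_Icc_null hμ (hc.continuous_abs_sub _)) ?_
  filter_upwards [measure_eq_zero_iff_ae_notMem.1 hv] with t ht
  rw [mem_Iio, not_lt] at ht
  refine hc.mono (abs_nonneg _) ?_
  rw [abs_of_nonpos (by linarith), abs_of_nonpos (by linarith)]
  linarith

theorem potential_mono_right [IsFiniteMeasure μ] (hc : IsConcaveCost c)
    (hμ : μ (Icc 0 ℓ)ᶜ = 0) {u s s' : ℝ} (hu : μ (Ioi u) = 0) (hs : u ≤ s) (hss : s ≤ s') :
    potential c μ s ≤ potential c μ s' := by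
  refine integral_mono_ae (integrable_of_compl_Icc_null hμ (hc.continuous_abs_sub _))
    (integrable_of_compl_Icc_null hμ (hc.continuous_abs_sub _)) ?_
  filter_upwards [measure_eq_zero_iff_ae_notMem.1 hu] with t ht
  rw [mem_Ioi, not_lt] at ht
  refine hc.mono (abs_nonneg _) ?_
  rw [abs_of_nonneg (by linarith), abs_of_nonneg (by linarith)]
  linarith

/-- On a gap of the support the potential is concave. -/
theorem le_potential_of_gap [IsFiniteMeasure μ] (hc : IsConcaveCost c)
    (hμ : μ (Icc 0 ℓ)ᶜ = 0) {u v a E : ℝ} (huv : μ (Ioo u v) = 0) (ha : a ∈ Icc u v)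
    (hu : E ≤ potential c μ u) (hv : E ≤ potential c μ v) : E ≤ potential c μ a := by
  have hle : u ≤ v := ha.1.trans ha.2
  rw [← segment_eq_Icc hle] at ha
  obtain ⟨p, q, hp, hq, hpq, rfl⟩ := ha
  have hi := fun s => integrable_of_compl_Icc_null hμ (hc.continuous_abs_sub s)
  have key : p * potential c μ u + q * potential c μ v ≤ potential c μ (p • u + q • v) := by
    unfold potential
    rw [← integral_const_mul, ← integral_const_mul,
      ← integral_add ((hi u).const_mul p) ((hi v).const_mul q)]
    refine integral_mono_ae (((hi u).const_mul p).add ((hi v).const_mul q)) (hi _) ?_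
    filter_upwards [measure_eq_zero_iff_ae_notMem.1 huv] with t ht
    have h := hc.concave.2 (mem_Ici.2 (abs_nonneg (u - t))) (mem_Ici.2 (abs_nonneg (v - t)))
      hp hq hpq
    simp only [smul_eq_mul] at h ⊢
    refine h.trans_eq ?_
    congr 1
    have h3 : p * u + q * v - t = p * (u - t) + q * (v - t) := by
      linear_combination t * hpq
    rw [h3]
    -- Since `t` avoids the open gap, `u - t` and `v - t` do not have opposite signs, so the
    -- absolute value is linear between them.
    rcases le_or_gt t u with h1 | h1
    · have h2 : 0 ≤ u - t := by linarith
      have h4 : 0 ≤ v - t := by linarith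
      rw [abs_of_nonneg h2, abs_of_nonneg h4,
        abs_of_nonneg (add_nonneg (mul_nonneg hp h2) (mul_nonneg hq h4))]
    · have h2 : u - t ≤ 0 := by linarith
      have h4 : v - t ≤ 0 := by
        by_contra! h4
        exact ht ⟨h1, by linarith⟩
      rw [abs_of_nonpos h2, abs_of_nonpos h4, abs_of_nonpos (add_nonpos
        (mul_nonpos_of_nonneg_of_nonpos hp h2) (mul_nonpos_of_nonneg_of_nonpos hq h4))]
      ring
  have h1 := mul_le_mul_of_nonneg_left hu hp
  have h2 := mul_le_mul_of_nonneg_left hv hq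
  have h3 : p * E + q * E = E := by rw [← add_mul, hpq, one_mul]
  linarith

end Potential

/-! ### Maximizing the energy of a kernel -/

section Energy

variable {K : Type*} [TopologicalSpace K] [CompactSpace K] [T2Space K]
  [SecondCountableTopology K] [MeasurableSpace K] [BorelSpace K] [Nonempty K]

/-- A probability measure maximizing the energy of a continuous symmetric kernel on a compact
space: its potential attains its maximum almost everywhere. -/
theorem exists_potential_le_and_ae_eq (g : K → K → ℝ) (hg : Continuous (Function.uncurry g))
    (hsymm : ∀ s t, g s t = g t s) :
    ∃ (μ : ProbabilityMeasure K) (E : ℝ), (∀ a, ∫ t, g a t ∂(μ : Measure K) ≤ E) ∧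
      ∀ᵐ a ∂(μ : Measure K), ∫ t, g a t ∂(μ : Measure K) = E := by
  let G : BoundedContinuousFunction (K × K) ℝ :=
    BoundedContinuousFunction.mkOfCompact ⟨Function.uncurry g, hg⟩
  have hcont : Continuous fun μ : ProbabilityMeasure K =>
      ∫ p, G p ∂((μ.prod μ : ProbabilityMeasure (K × K)) : Measure (K × K)) :=
    (ProbabilityMeasure.continuous_integral_boundedContinuousFunction G).comp
      (ProbabilityMeasure.continuous_prod.comp (continuous_id.prodMk continuous_id))
  have hUc : ∀ (ν : Measure K) [IsFiniteMeasure ν], Continuous fun a => ∫ t, g a t ∂ν :=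
    fun ν _ => by
      have := continuous_parametric_integral_of_continuous (μ := ν) (f := g) hg isCompact_univ
      simpa using this
  have hint : ∀ (ν : Measure K) [IsFiniteMeasure ν] (f : K → ℝ), Continuous f → Integrable f ν :=
    fun ν _ f hf => hf.integrable_of_hasCompactSupport (HasCompactSupport.of_compactSpace _)
  have henergy : ∀ μ : ProbabilityMeasure K,
      ∫ p, G p ∂((μ.prod μ : ProbabilityMeasure (K × K)) : Measure (K × K)) =
        ∫ a, ∫ t, g a t ∂(μ : Measure K) ∂(μ : Measure K) := fun μ => by
    rw [ProbabilityMeasure.toMeasure_prod, integral_prod _ (G.integrable _)]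
    rfl
  obtain ⟨a₀⟩ := ‹Nonempty K›
  have : Nonempty (ProbabilityMeasure K) := ⟨⟨Measure.dirac a₀, inferInstance⟩⟩
  obtain ⟨μ, -, hμ⟩ := isCompact_univ.exists_isMaxOn
    (univ_nonempty (α := ProbabilityMeasure K)) hcont.continuousOn
  set E := ∫ a, ∫ t, g a t ∂(μ : Measure K) ∂(μ : Measure K) with hE
  have hle : ∀ a, ∫ t, g a t ∂(μ : Measure K) ≤ E := by
    intro a
    by_contra! hlt
    set U := ∫ t, g a t ∂(μ : Measure K) with hU
    set D := U - E with hD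
    have hDpos : 0 < D := by linarith
    set M := |E - g a a| with hM
    have hM0 : 0 ≤ M := abs_nonneg _
    -- Moving mass `ε` to `a` changes the energy by `ε * (2 * (1 - ε) * D - ε * (E - g a a))`. With
    -- this `ε` the second factor is at least `D > 0`, contradicting maximality.
    set ε := D / (M + 2 * D) with hε
    have hden : 0 < M + 2 * D := by linarith
    have hε0 : 0 < ε := div_pos hDpos hden
    have hε1 : ε ≤ 1 := by rw [hε, div_le_one hden]; linarith
    have hεD : ε * (M + 2 * D) = D := div_mul_cancel₀ _ hden.ne'
    let ν : Measure K := ENNReal.ofReal (1 - ε) • (μ : Measure K) +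
      ENNReal.ofReal ε • Measure.dirac a
    have hνprob : IsProbabilityMeasure ν := ⟨by
      simp only [ν, Measure.add_apply, Measure.smul_apply, measure_univ, smul_eq_mul, mul_one]
      rw [← ENNReal.ofReal_add (by linarith) hε0.le]
      simp⟩
    have hνint : ∀ f : K → ℝ, Continuous f →
        ∫ t, f t ∂ν = (1 - ε) * ∫ t, f t ∂(μ : Measure K) + ε * f a := by
      intro f hf
      rw [integral_add_measure ((hint _ f hf).smul_measure ENNReal.ofReal_ne_top)
        ((hint _ f hf).smul_measure ENNReal.ofReal_ne_top), integral_smul_measure,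
        integral_smul_measure, integral_dirac, ENNReal.toReal_ofReal (by linarith),
        ENNReal.toReal_ofReal hε0.le]
      rfl
    have hmax : ∫ s, ∫ t, g s t ∂ν ∂ν ≤ E := by
      let ν' : ProbabilityMeasure K := ⟨ν, hνprob⟩
      exact ((henergy ν').symm.trans_le (isMaxOn_iff.1 hμ ν' (mem_univ _))).trans_eq (henergy μ)
    have h1 : ∀ s, ∫ t, g s t ∂ν = (1 - ε) * ∫ t, g s t ∂(μ : Measure K) + ε * g s a :=
      fun s => hνint _ (hg.comp (Continuous.prodMk_right s))
    have hga : Continuous fun s => g s a := hg.comp (Continuous.prodMk_left a)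
    have h2 : ∫ s, ∫ t, g s t ∂ν ∂ν =
        (1 - ε) * ((1 - ε) * E + ε * U) + ε * ((1 - ε) * U + ε * g a a) := by
      rw [hνint _ (hUc ν)]
      simp only [h1]
      rw [integral_add ((hint _ _ (hUc _)).const_mul _) ((hint _ _ hga).const_mul _),
        integral_const_mul, integral_const_mul, hU, hE]
      simp only [hsymm _ a]
    rw [h2] at hmax
    have hMle : E - g a a ≤ M := le_abs_self _
    have h3 : ε * (2 * (1 - ε) * D - ε * (E - g a a)) ≤ 0 := by
      rw [hD]; linarith [hmax]
    have h4 : 2 * (1 - ε) * D - ε * (E - g a a) ≤ 0 := by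
      by_contra! h5
      linarith [mul_pos hε0 h5]
    nlinarith
  refine ⟨μ, E, hle, ?_⟩
  -- The energy is the mean of the potential, so the nonnegative defect `E - potential` has integral
  -- zero.
  have hnn : 0 ≤ᵐ[(μ : Measure K)] fun a => E - ∫ t, g a t ∂(μ : Measure K) :=
    Filter.Eventually.of_forall fun a => sub_nonneg.2 (hle a)
  have hz : ∫ a, (E - ∫ t, g a t ∂(μ : Measure K)) ∂(μ : Measure K) = 0 := by
    rw [integral_sub (integrable_const _) (hint _ _ (hUc _)), ← hE]
    simp
  rw [integral_eq_zero_iff_of_nonneg_ae hnn ((integrable_const _).sub (hint _ _ (hUc _)))] at hz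
  filter_upwards [hz] with a ha
  simp only [Pi.zero_apply] at ha
  linarith

end Energy

/-- The energy maximizer works: its potential never exceeds `E`, and equals `E` on a closed set `G`
of full measure. A point outside `G` lies either in a gap of `G`, where the potential is concave, or
beyond all of `G`, where moving away from `G` cannot lower the potential. -/
theorem exists_isEqualizing {c : ℝ → ℝ} (hc : IsConcaveCost c) {ℓ : ℝ} (hℓ : 0 ≤ ℓ) :
    ∃ μ : ProbabilityMeasure ℝ, IsEqualizing c ℓ μ := by
  have : Nonempty (Icc 0 ℓ) := ⟨⟨0, le_rfl, hℓ⟩⟩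
  obtain ⟨μ₀, E, hle, hae⟩ := exists_potential_le_and_ae_eq
    (K := Icc 0 ℓ) (fun s t => c |(s : ℝ) - t|)
    (hc.continuous_kernel.comp (continuous_subtype_val.prodMap continuous_subtype_val))
    (fun s t => by rw [abs_sub_comm])
  have hval : MeasurableEmbedding (Subtype.val : Icc 0 ℓ → ℝ) :=
    MeasurableEmbedding.subtype_coe measurableSet_Icc
  let μ : ProbabilityMeasure ℝ := μ₀.map hval.measurable.aemeasurable
  have hμcoe : (μ : Measure ℝ) = (μ₀ : Measure (Icc 0 ℓ)).map Subtype.val := rfl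
  have hsupp : (μ : Measure ℝ) (Icc 0 ℓ)ᶜ = 0 := by
    rw [hμcoe, hval.map_apply]
    simp
  have hpot : ∀ s, potential c μ s = ∫ t : Icc 0 ℓ, c |s - t| ∂(μ₀ : Measure (Icc 0 ℓ)) :=
    fun s => by rw [potential, hμcoe, hval.integral_map]
  have hUle : ∀ a ∈ Icc 0 ℓ, potential c μ a ≤ E := fun a ha => by
    rw [hpot]; exact hle ⟨a, ha⟩
  let G : Set ℝ := Icc 0 ℓ ∩ {t | E ≤ potential c μ t}
  have hGcl : IsCompact G := isCompact_Icc.inter_right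
    (isClosed_le continuous_const (continuous_potential hc hsupp))
  have hGnull : (μ : Measure ℝ) Gᶜ = 0 := by
    rw [hμcoe, hval.map_apply, measure_eq_zero_iff_ae_notMem]
    filter_upwards [hae] with a ha
    simp only [mem_preimage, mem_compl_iff, not_not]
    refine ⟨a.2, ?_⟩
    rw [mem_ofPred_eq, hpot]
    exact ha.ge
  have hGne : G.Nonempty := by
    rw [nonempty_iff_ne_empty]
    intro h
    rw [h, compl_empty, measure_univ] at hGnull
    exact one_ne_zero hGnull
  have hsub : ∀ s : Set ℝ, Disjoint s G → (μ : Measure ℝ) s = 0 := fun s hs =>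
    measure_mono_null (subset_compl_iff_disjoint_right.2 hs) hGnull
  have heq : ∀ a ∈ Icc 0 ℓ, potential c μ a = E := by
    intro a ha
    refine le_antisymm (hUle a ha) ?_
    -- Compare `a` with the nearest points of `G` on either side; if one side is empty, monotonicity
    -- from the other side suffices.
    rcases (G ∩ Iic a).eq_empty_or_nonempty with hL | hL
    · obtain ⟨v, hvG, hvmin⟩ := hGcl.exists_isLeast hGne
      have hav : a ≤ v := by
        by_contra! h
        exact eq_empty_iff_forall_notMem.1 hL v ⟨hvG, h.le⟩
      refine hvG.2.trans (potential_anti_left hc hsupp (v := v) (hsub _ ?_) hav le_rfl)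
      exact disjoint_left.2 fun t ht htG => not_lt.2 (hvmin htG) ht
    · obtain ⟨u, hu, humax⟩ := (hGcl.inter_right isClosed_Iic).exists_isGreatest hL
      rcases (G ∩ Ici a).eq_empty_or_nonempty with hR | hR
      · refine hu.1.2.trans (potential_mono_right hc hsupp (u := u) (hsub _ ?_) le_rfl hu.2)
        refine disjoint_left.2 fun t ht htG => ?_
        have hta : t ≤ a := by
          by_contra! h
          exact eq_empty_iff_forall_notMem.1 hR t ⟨htG, h.le⟩
        exact not_lt.2 (humax ⟨htG, hta⟩) ht
      · obtain ⟨v, hv, hvmin⟩ := (hGcl.inter_right isClosed_Ici).exists_isLeast hR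
        refine le_potential_of_gap hc hsupp (u := u) (v := v) (hsub _ ?_) ⟨hu.2, hv.2⟩ hu.1.2 hv.1.2
        refine disjoint_left.2 fun t ht htG => ?_
        rcases le_total t a with h | h
        · exact not_lt.2 (humax ⟨htG, h⟩) ht.1
        · exact not_lt.2 (hvmin ⟨htG, h⟩) ht.2
  exact ⟨μ, hsupp, fun a ha b hb => (heq a ha).trans (heq b hb).symm⟩

/-! ### Coverings of minimum length -/

section Covering

variable {k n : ℕ}

/-- Points covered by `k` intervals of length `L` are covered by `k` disjoint ones: place
the intervals greedily from left to right. -/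
theorem exists_separated_cover {L : ℝ} (hL : 0 ≤ L) :
    ∀ (k : ℕ) (T : Finset ℝ) (b : ℝ), (∀ t ∈ T, b < t) → ∀ β : Fin k → ℝ,
      (∀ t ∈ T, ∃ j, t ∈ Icc (β j) (β j + L)) →
      ∃ α : Fin k → ℝ, (∀ j, b < α j) ∧ (∀ i j, i < j → α i + L < α j) ∧
        ∀ t ∈ T, ∃ j, t ∈ Icc (α j) (α j + L) := by
  intro k
  induction k with
  | zero =>
    intro T b _ β hβ
    exact ⟨β, fun j => j.elim0, fun i => i.elim0, hβ⟩
  | succ k ih =>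
    intro T b hb β hβ
    -- The new interval starts at the leftmost point `m`. The old interval `j₀` containing `m` ends
    -- no later than `m + L`, so the points beyond `m + L` are covered by the other `k` intervals.
    -- With no points left, any `m > b` and any `j₀` will do.
    obtain ⟨m, hbm, hmin, j₀, hj₀⟩ : ∃ m, b < m ∧ (∀ t ∈ T, m ≤ t) ∧
        ∃ j₀, ∀ t ∈ T, t ∈ Icc (β j₀) (β j₀ + L) → t ≤ m + L := by
      rcases T.eq_empty_or_nonempty with rfl | hT
      · exact ⟨b + 1, by linarith, by simp, 0, by simp⟩
      · obtain ⟨m, hm, hmin⟩ := T.exists_min_image id hT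
        obtain ⟨j₀, hj₀⟩ := hβ m hm
        exact ⟨m, hb m hm, hmin, j₀, fun t _ ht => by linarith [ht.2, hj₀.1]⟩
    obtain ⟨α, hα1, hα2, hα3⟩ := ih (T.filter fun t => m + L < t) (m + L)
      (fun t ht => (Finset.mem_filter.1 ht).2) (fun j => β (j₀.succAbove j)) (by
        intro t ht
        obtain ⟨htT, htm⟩ := Finset.mem_filter.1 ht
        obtain ⟨j, hj⟩ := hβ t htT
        have hne : j ≠ j₀ := by
          rintro rfl
          exact absurd (hj₀ t htT hj) (not_le.2 htm)
        obtain ⟨i, rfl⟩ := Fin.exists_succAbove_eq hne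
        exact ⟨i, hj⟩)
    refine ⟨Fin.cons m α, ?_, ?_, ?_⟩
    · intro j
      cases j using Fin.cases with
      | zero => simpa using hbm
      | succ j => simpa using (by linarith [hα1 j] : b < α j)
    · intro i j hij
      cases j using Fin.cases with
      | zero => exact absurd hij (Fin.not_lt_zero i)
      | succ j =>
        cases i using Fin.cases with
        | zero => simpa using hα1 j
        | succ i => simpa using hα2 i j (Fin.succ_lt_succ_iff.1 hij)
    · intro t ht
      rcases lt_or_ge (m + L) t with h | h
      · obtain ⟨j, hj⟩ := hα3 t (Finset.mem_filter.2 ⟨ht, h⟩)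
        exact ⟨j.succ, by simpa using hj⟩
      · exact ⟨0, by simpa using ⟨hmin t ht, h⟩⟩

/-- Disjointness and order cost nothing in length, so minimality of `ℓ` can be tested against
arbitrary, possibly overlapping, coverings. -/
theorem exists_isCovering {x : Fin n → ℝ} {L : ℝ} (hL : 0 ≤ L) {β : Fin k → ℝ}
    (hβ : ∀ i, ∃ j, x i ∈ Icc (β j) (β j + L)) : ∃ α : Fin k → ℝ, IsCovering x L α := by
  obtain ⟨b, hb⟩ := (Finset.univ.image x).bddBelow
  obtain ⟨α, -, hsep, hcov⟩ := exists_separated_cover hL k (Finset.univ.image x) (b - 1)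
    (fun t ht => by linarith [hb (Finset.mem_coe.2 ht)]) β (by simpa using hβ)
  refine ⟨α, hL, fun i j hij => by linarith [hsep i j hij], ?_, by simpa using hcov⟩
  intro i j hij
  rw [disjoint_left]
  rintro t ⟨h1, h2⟩ ⟨h3, h4⟩
  rcases lt_or_gt_of_ne hij with h | h
  · linarith [hsep i j h]
  · linarith [hsep j i h]

theorem IsCovering.separated {x : Fin n → ℝ} {ℓ : ℝ} {α : Fin k → ℝ} (h : IsCovering x ℓ α)
    {i j : Fin k} (hij : i < j) : α i + ℓ < α j := by
  by_contra! hle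
  exact disjoint_left.1 (h.disjoint hij.ne) ⟨(h.strictMono hij).le, hle⟩
    ⟨le_rfl, by linarith [h.length_nonneg]⟩

theorem IsMinLength.le_of_cover {x : Fin n → ℝ} {ℓ L : ℝ} (h : IsMinLength k x ℓ) (hL : 0 ≤ L)
    {β : Fin k → ℝ} (hβ : ∀ i, ∃ j, x i ∈ Icc (β j) (β j + L)) : ℓ ≤ L :=
  h.2 (exists_isCovering hL hβ)

/-- The length of a covering can be decreased to a distance between two agents. -/
theorem IsCovering.exists_le_mem_range_sub [NeZero n] {x : Fin n → ℝ} {ℓ : ℝ} {α : Fin k → ℝ}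
    (h : IsCovering x ℓ α) :
    ∃ l ∈ range fun p : Fin n × Fin n => x p.1 - x p.2,
      (∃ α : Fin k → ℝ, IsCovering x l α) ∧ l ≤ ℓ := by
  -- `l` is the largest difference of two locations in `[0, ℓ]`. Agents sharing an interval differ
  -- by at most `ℓ`, hence by at most `l`.
  obtain ⟨l, ⟨hlr, hl0, hlℓ⟩, hmax⟩ := Set.exists_max_image
    ((range fun p : Fin n × Fin n => x p.1 - x p.2) ∩ Icc 0 ℓ) id
    ((finite_range _).inter_of_left _) ⟨0, ⟨(0, 0), by simp⟩, le_rfl, h.length_nonneg⟩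
  refine ⟨l, hlr, ?_, hlℓ⟩
  have hβ : ∀ j, ∃ b, ∀ i, x i ∈ Icc (α j) (α j + ℓ) → x i ∈ Icc b (b + l) := by
    intro j
    rcases {i | x i ∈ Icc (α j) (α j + ℓ)}.eq_empty_or_nonempty with he | hne
    · exact ⟨0, fun i hi => absurd hi (eq_empty_iff_forall_notMem.1 he i)⟩
    · obtain ⟨i₀, hi₀, hmin⟩ := Set.exists_min_image _ x (toFinite _) hne
      refine ⟨x i₀, fun i hi => ⟨hmin i hi, ?_⟩⟩
      have h1 := hmax (x i - x i₀) ⟨⟨(i, i₀), rfl⟩, by linarith [hmin i hi],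
        by linarith [hi.2, hi₀.1]⟩
      simp only [id] at h1
      linarith
  choose β hβ using hβ
  refine exists_isCovering hl0 (β := β) fun i => ?_
  obtain ⟨j, hj⟩ := h.covers i
  exact ⟨j, hβ j i hj⟩

/-- Only the finitely many differences between agents compete for the minimum, so it is attained. -/
theorem exists_isMinLength [NeZero n] [NeZero k] (x : Fin n → ℝ) : ∃ ℓ, IsMinLength k x ℓ := by
  obtain ⟨b, hb⟩ := (finite_range x).bddBelow
  obtain ⟨B, hB⟩ := (finite_range x).bddAbove
  have hbi : ∀ i, b ≤ x i := fun i => hb (mem_range_self i)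
  have hBi : ∀ i, x i ≤ B := fun i => hB (mem_range_self i)
  obtain ⟨α, hα⟩ := exists_isCovering (k := k) (x := x) (L := B - b)
    (by linarith [hbi 0, hBi 0]) (β := fun _ => b)
    fun i => ⟨0, hbi i, by linarith [hBi i]⟩
  obtain ⟨l, hlr, hlA, -⟩ := hα.exists_le_mem_range_sub
  obtain ⟨m, ⟨hmA, -⟩, hmin⟩ := Set.exists_min_image
    ({l : ℝ | ∃ α : Fin k → ℝ, IsCovering x l α} ∩
      range fun p : Fin n × Fin n => x p.1 - x p.2) id
    ((finite_range _).inter_of_right _) ⟨l, hlA, hlr⟩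
  refine ⟨m, hmA, ?_⟩
  rintro l' ⟨α', hα'⟩
  obtain ⟨l'', hr, hA, hle⟩ := hα'.exists_le_mem_range_sub
  exact (hmin l'' ⟨hA, hr⟩).trans hle

/-! ### Folding and the nearest facility -/

/-- The coordinate of `a` relative to the `j`-th interval, reflected in every other interval. -/
def foldCoord (ℓ : ℝ) (α : Fin k → ℝ) (j : Fin k) (a : ℝ) : ℝ :=
  if Even (j : ℕ) then a - α j else α j + ℓ - a

theorem abs_sub_placement (ℓ : ℝ) (α : Fin k → ℝ) (t a : ℝ) (j : Fin k) :
    |a - placement ℓ α t j| = |foldCoord ℓ α j a - t| := by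
  unfold placement foldCoord
  split_ifs
  · congr 1; ring
  · rw [abs_sub_comm]; congr 1; ring

theorem abs_foldCoord_sub_half (ℓ : ℝ) (α : Fin k → ℝ) (j : Fin k) (a : ℝ) :
    |foldCoord ℓ α j a - ℓ / 2| = |a - (α j + ℓ / 2)| := by
  unfold foldCoord
  split_ifs
  · congr 1; ring
  · rw [abs_sub_comm]; congr 1; ring

theorem abs_sub_le_of_add_le {p q t : ℝ} (h : q ≤ p) (ht : p + q ≤ 2 * t) : |p - t| ≤ |q - t| := by
  refine abs_le.2 ⟨?_, ?_⟩ <;> linarith [neg_le_abs (q - t), le_abs_self (q - t)]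

theorem abs_sub_le_of_le_add {p q t : ℝ} (h : p ≤ q) (ht : 2 * t ≤ p + q) : |p - t| ≤ |q - t| := by
  refine abs_le.2 ⟨?_, ?_⟩ <;> linarith [neg_le_abs (q - t), le_abs_self (q - t)]

theorem add_le_of_abs_sub_le {a p q : ℝ} (hpq : p < q) (h : |a - p| ≤ |a - q|) :
    2 * a ≤ p + q := by
  have := sq_le_sq.2 h
  nlinarith

theorem le_add_of_abs_sub_le {a p q : ℝ} (hpq : q < p) (h : |a - p| ≤ |a - q|) :
    p + q ≤ 2 * a := by
  have := sq_le_sq.2 h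
  nlinarith

/-- Thanks to the reflection, the facility nearest to `a` is, for every sample `t`, the one in the
interval whose midpoint is nearest to `a`. -/
theorem exists_nearest [NeZero k] {ℓ : ℝ} (hℓ : 0 ≤ ℓ) {α : Fin k → ℝ}
    (hsep : ∀ i j, i < j → α i + ℓ < α j) (a : ℝ) :
    ∃ j, (∀ m, |foldCoord ℓ α j a - ℓ / 2| ≤ |foldCoord ℓ α m a - ℓ / 2|) ∧
      ∀ t ∈ Icc 0 ℓ, ∀ m, |foldCoord ℓ α j a - t| ≤ |foldCoord ℓ α m a - t| := by
  obtain ⟨j, hj⟩ := Finite.exists_min fun j => |a - (α j + ℓ / 2)|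
  refine ⟨j, fun m => by simpa only [abs_foldCoord_sub_half] using hj m, ?_⟩
  rintro t ⟨ht0, htℓ⟩ m
  have hright : ∀ i, j < i → 2 * a ≤ α j + α i + ℓ := fun i hi => by
    have := add_le_of_abs_sub_le (by linarith [hsep j i hi]) (hj i)
    linarith
  have hleft : ∀ i, i < j → α j + α i + ℓ ≤ 2 * a := fun i hi => by
    have := le_add_of_abs_sub_le (by linarith [hsep i j hi]) (hj i)
    linarith
  rcases lt_trichotomy j m with hjm | rfl | hjm
  · have h1 := hright m hjm
    have h2 := hsep j m hjm
    -- For opposite parities the midpoint of the two facilities does not depend on `t`, so comparing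
    -- interval midpoints suffices. For equal parities the interval `j + 1` lies strictly between;
    -- comparing with its midpoint gains the extra `ℓ` that absorbs the common shift by `t` or `ℓ -
    -- t`.
    have h3 : (Even (j : ℕ) ↔ Even (m : ℕ)) → 2 * a ≤ α j + α m := fun hpar => by
      have hlt : (j : ℕ) + 1 < m := by
        refine lt_of_le_of_ne (Nat.succ_le_of_lt hjm) fun h => ?_
        rw [← h, Nat.even_add_one] at hpar
        tauto
      have h4 := hright ⟨j + 1, hlt.trans m.2⟩ (Fin.lt_def.2 (Nat.lt_succ_self _))
      have h5 := hsep ⟨j + 1, hlt.trans m.2⟩ m (Fin.lt_def.2 hlt)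
      linarith
    unfold foldCoord
    split_ifs with hej hem hem
    · exact abs_sub_le_of_add_le (by linarith) (by linarith [h3 (by tauto)])
    · exact abs_sub_le_of_le_add (by linarith) (by linarith)
    · exact abs_sub_le_of_add_le (by linarith) (by linarith)
    · exact abs_sub_le_of_le_add (by linarith) (by linarith [h3 (by tauto)])
  · exact le_rfl
  · have h1 := hleft m hjm
    have h2 := hsep m j hjm
    have h3 : (Even (j : ℕ) ↔ Even (m : ℕ)) → α j + α m + 2 * ℓ ≤ 2 * a := fun hpar => by
      have hlt : (m : ℕ) + 1 < j := by
        refine lt_of_le_of_ne (Nat.succ_le_of_lt hjm) fun h => ?_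
        rw [← h, Nat.even_add_one] at hpar
        tauto
      have h4 := hleft ⟨m + 1, hlt.trans j.2⟩ (Fin.lt_def.2 hlt)
      have h5 := hsep m ⟨m + 1, hlt.trans j.2⟩ (Fin.lt_def.2 (Nat.lt_succ_self _))
      linarith
    unfold foldCoord
    split_ifs with hej hem hem
    · exact abs_sub_le_of_le_add (by linarith) (by linarith [h3 (by tauto)])
    · exact abs_sub_le_of_add_le (by linarith) (by linarith)
    · exact abs_sub_le_of_le_add (by linarith) (by linarith)
    · exact abs_sub_le_of_add_le (by linarith) (by linarith [h3 (by tauto)])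

end Covering

variable {k n : ℕ} {c : ℝ → ℝ}

/-! ### Potentials of equalizing laws -/

section Equalizing

theorem IsEqualizing.potential_eq {ℓ : ℝ} {μ : ProbabilityMeasure ℝ} (h : IsEqualizing c ℓ μ)
    {a : ℝ} (ha : a ∈ Icc 0 ℓ) : potential c μ a = potential c μ 0 :=
  h.equal a ha 0 ⟨le_rfl, ha.1.trans ha.2⟩

theorem IsEqualizing.potential_anti {ℓ : ℝ} {μ : ProbabilityMeasure ℝ} (h : IsEqualizing c ℓ μ)
    (hc : IsConcaveCost c) {s s' : ℝ} (hss : s ≤ s') (hs : s' ≤ 0) :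
    potential c μ s' ≤ potential c μ s :=
  potential_anti_left hc h.support
    (measure_mono_null (t := (Icc 0 ℓ)ᶜ) (fun _ ht ht' => not_lt.2 ht'.1 ht) h.support) hss hs

theorem IsEqualizing.potential_mono {ℓ : ℝ} {μ : ProbabilityMeasure ℝ} (h : IsEqualizing c ℓ μ)
    (hc : IsConcaveCost c) {s s' : ℝ} (hs : ℓ ≤ s) (hss : s ≤ s') :
    potential c μ s ≤ potential c μ s' :=
  potential_mono_right hc h.support
    (measure_mono_null (t := (Icc 0 ℓ)ᶜ) (fun _ ht ht' => not_lt.2 ht'.2 ht) h.support) hs hss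

/-- The potential is constant on `[0, ℓ]` and does not decrease when moving away from it. -/
theorem IsEqualizing.potential_zero_le {ℓ : ℝ} {μ : ProbabilityMeasure ℝ}
    (h : IsEqualizing c ℓ μ) (hc : IsConcaveCost c) (hℓ : 0 ≤ ℓ) (s : ℝ) :
    potential c μ 0 ≤ potential c μ s := by
  rcases le_total s 0 with h0 | h0
  · exact h.potential_anti hc h0 le_rfl
  · rcases le_total s ℓ with h1 | h1
    · exact (h.potential_eq ⟨h0, h1⟩).ge
    · rw [← h.potential_eq (right_mem_Icc.2 hℓ)]
      exact h.potential_mono hc le_rfl h1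

/-- Evaluate the constant at the midpoint, which is never farther than `ℓ / 2` from the facility. -/
theorem IsEqualizing.potential_zero_le_cost_half {ℓ : ℝ} {μ : ProbabilityMeasure ℝ}
    (h : IsEqualizing c ℓ μ) (hc : IsConcaveCost c) (hℓ : 0 ≤ ℓ) :
    potential c μ 0 ≤ c (ℓ / 2) := by
  rw [← h.potential_eq (a := ℓ / 2) ⟨by linarith, by linarith⟩]
  calc potential c μ (ℓ / 2) ≤ ∫ _, c (ℓ / 2) ∂(μ : Measure ℝ) := by
        refine integral_mono_ae (integrable_of_compl_Icc_null h.support (hc.continuous_abs_sub _))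
          (integrable_const _) ?_
        filter_upwards [measure_eq_zero_iff_ae_notMem.1 h.support] with t ht
        rw [mem_compl_iff, not_not] at ht
        exact hc.mono (abs_nonneg _) (abs_le.2 ⟨by linarith [ht.2], by linarith [ht.1]⟩)
    _ = c (ℓ / 2) := by simp

theorem integrable_prod_of_compl_Icc_null {μ ν : Measure ℝ} [IsFiniteMeasure μ]
    [IsFiniteMeasure ν] {ℓ ℓ' : ℝ} (hμ : μ (Icc 0 ℓ)ᶜ = 0) (hν : ν (Icc 0 ℓ')ᶜ = 0)
    {f : ℝ × ℝ → ℝ} (hf : Continuous f) : Integrable f (μ.prod ν) := by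
  rw [← Measure.restrict_eq_self_of_ae_mem (μ := μ) (s := Icc 0 ℓ) hμ,
    ← Measure.restrict_eq_self_of_ae_mem (μ := ν) (s := Icc 0 ℓ') hν, Measure.prod_restrict]
  exact hf.continuousOn.integrableOn_compact (isCompact_Icc.prod isCompact_Icc)

/-- The equalized cost for length `ℓ` is at most the larger of the costs, for an equalizing
distribution on `[0, ℓ']`, at the end points of an interval `[lo, hi]` of length at least `ℓ`. -/
theorem IsEqualizing.potential_zero_le_max {ℓ ℓ' lo hi : ℝ} {μ ν : ProbabilityMeasure ℝ}
    (hc : IsConcaveCost c) (hμ : IsEqualizing c ℓ' μ) (hν : IsEqualizing c ℓ ν) (hℓ : 0 ≤ ℓ)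
    (hℓ' : 0 ≤ ℓ') (hle : ℓ ≤ hi - lo) :
    potential c ν 0 ≤ max (potential c μ lo) (potential c μ hi) := by
  have hbound : ∀ s ∈ Icc lo hi, potential c μ s ≤ max (potential c μ lo) (potential c μ hi) := by
    rintro s ⟨h1, h2⟩
    rcases le_total s 0 with h0 | h0
    · exact le_max_of_le_left (hμ.potential_anti hc h1 h0)
    · rcases le_total s ℓ' with h3 | h3
      · rw [hμ.potential_eq ⟨h0, h3⟩]
        exact le_max_of_le_left (hμ.potential_zero_le hc hℓ' lo)
      · exact le_max_of_le_right (hμ.potential_mono hc h3 h2)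
  have hcν := continuous_potential hc hν.support
  have hcμ := continuous_potential hc hμ.support
  -- Average `c` of the distance between `s` and `lo + t`, for independent `s` with law `μ` and `t`
  -- with law `ν`. Integrating over `t` first bounds it below by the least `ν`-potential;
  -- integrating over `s` first bounds it above, since `lo + t` stays in `[lo, hi]`.
  calc potential c ν 0 = ∫ _, potential c ν 0 ∂(μ : Measure ℝ) := by simp
    _ ≤ ∫ s, potential c ν (s - lo) ∂(μ : Measure ℝ) :=
        integral_mono (integrable_const _) (integrable_of_compl_Icc_null hμ.support
          (hcν.comp (continuous_id.sub continuous_const)))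
          fun s => hν.potential_zero_le hc hℓ (s - lo)
    _ = ∫ t, ∫ s, c |s - lo - t| ∂(μ : Measure ℝ) ∂(ν : Measure ℝ) :=
        integral_integral_swap (integrable_prod_of_compl_Icc_null hμ.support hν.support
          (hc.continuous_comp_abs.comp
            ((continuous_fst.sub continuous_const).sub continuous_snd)))
    _ = ∫ t, potential c μ (t + lo) ∂(ν : Measure ℝ) := by
        refine integral_congr_ae (Filter.Eventually.of_forall fun t => ?_)
        refine integral_congr_ae (Filter.Eventually.of_forall fun s => ?_)
        simp only
        rw [abs_sub_comm]
        congr 2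
        ring
    _ ≤ ∫ _, max (potential c μ lo) (potential c μ hi) ∂(ν : Measure ℝ) := by
        refine integral_mono_ae (integrable_of_compl_Icc_null hν.support
          (hcμ.comp (continuous_id.add continuous_const))) (integrable_const _) ?_
        filter_upwards [measure_eq_zero_iff_ae_notMem.1 hν.support] with t ht
        rw [mem_compl_iff, not_not] at ht
        exact hbound _ ⟨by linarith [ht.1], by linarith [ht.2]⟩
    _ = _ := by simp

end Equalizing

/-! ### Costs and the optimal values -/

section Costs

theorem cost_nonneg (hc : IsConcaveCost c) (a : ℝ) (y : Fin k → ℝ) : 0 ≤ cost c a y :=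
  hc.nonneg _ (Real.iInf_nonneg fun _ => abs_nonneg _)

theorem cost_le_of_abs_le (hc : IsConcaveCost c) {a d : ℝ} {y : Fin k → ℝ} {j : Fin k}
    (h : |a - y j| ≤ d) : cost c a y ≤ c d :=
  hc.mono (Real.iInf_nonneg fun _ => abs_nonneg _)
    ((ciInf_le (finite_range _).bddBelow j).trans h)

theorem cost_le_maxCost (c : ℝ → ℝ) (x : Fin n → ℝ) (y : Fin k → ℝ) (i : Fin n) :
    cost c (x i) y ≤ maxCost c x y :=
  le_ciSup (f := fun i => cost c (x i) y) (finite_range _).bddAbove i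

theorem continuous_iInf_abs_sub [NeZero k] (a : ℝ) :
    Continuous fun y : Fin k → ℝ => ⨅ j, |a - y j| := by
  simp_rw [← Finset.inf'_univ_eq_ciInf]
  exact Continuous.finset_inf'_apply _ fun j _ => (continuous_const.sub (continuous_apply j)).abs

theorem continuous_cost [NeZero k] (hc : IsConcaveCost c) (a : ℝ) :
    Continuous fun y : Fin k → ℝ => cost c a y :=
  hc.continuous.comp_continuous (continuous_iInf_abs_sub a)
    fun _ => Real.iInf_nonneg fun _ => abs_nonneg _

theorem continuous_maxCost [NeZero k] [NeZero n] (hc : IsConcaveCost c) (x : Fin n → ℝ) :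
    Continuous fun y : Fin k → ℝ => maxCost c x y := by
  unfold maxCost
  simp_rw [← Finset.sup'_univ_eq_ciSup]
  exact Continuous.finset_sup'_apply _ fun i _ => continuous_cost hc (x i)

theorem continuous_placement (ℓ : ℝ) (α : Fin k → ℝ) : Continuous (placement ℓ α) := by
  refine continuous_pi fun j => ?_
  unfold placement
  split_ifs <;> fun_prop

/-- Midpoints of a shortest covering achieve the value. Conversely, if all agents are within `r` of
the facilities `y`, the intervals of length `2 * r` centred at `y` cover them, so `ℓ ≤ 2 * r`. -/
theorem optMaxCost_eq [NeZero n] [NeZero k] (hc : IsConcaveCost c) {x : Fin n → ℝ} {ℓ : ℝ}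
    (hℓ : IsMinLength k x ℓ) : optMaxCost k c x = c (ℓ / 2) := by
  obtain ⟨α, hα⟩ := hℓ.1
  refine le_antisymm ?_ (le_ciInf fun y => ?_)
  · have hbdd : BddBelow (range fun y : Fin k → ℝ => maxCost c x y) :=
      ⟨0, forall_mem_range.2 fun y => (cost_nonneg hc _ _).trans (cost_le_maxCost c x y 0)⟩
    refine (ciInf_le hbdd fun j => α j + ℓ / 2).trans (ciSup_le fun i => ?_)
    obtain ⟨j, hj⟩ := hα.covers i
    exact cost_le_of_abs_le hc (j := j) (abs_le.2 ⟨by linarith [hj.1], by linarith [hj.2]⟩)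
  · obtain ⟨i₀, hi₀⟩ := Finite.exists_max fun i => ⨅ j, |x i - y j|
    set r := ⨅ j, |x i₀ - y j| with hr
    have hr0 : 0 ≤ r := Real.iInf_nonneg fun _ => abs_nonneg _
    have hle : ℓ ≤ 2 * r := hℓ.le_of_cover (by linarith) (β := fun j => y j - r) fun i => by
      obtain ⟨j, hj⟩ := exists_eq_ciInf_of_finite (f := fun j => |x i - y j|)
      have h := abs_le.1 (hj.trans_le (hi₀ i))
      exact ⟨j, by linarith [h.1], by linarith [h.2]⟩
    exact (hc.mono (by linarith [hα.length_nonneg]) (by linarith)).trans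
      (cost_le_maxCost c x y i₀)

theorem optMaxCost_le_optSocialCost [NeZero n] (hc : IsConcaveCost c) (x : Fin n → ℝ) :
    optMaxCost k c x ≤ optSocialCost k c x := by
  have hbdd : BddBelow (range fun y : Fin k → ℝ => maxCost c x y) :=
    ⟨0, forall_mem_range.2 fun y => (cost_nonneg hc _ _).trans (cost_le_maxCost c x y 0)⟩
  refine ciInf_mono hbdd fun y => ciSup_le fun i => ?_
  exact Finset.single_le_sum (f := fun i => cost c (x i) y) (fun i _ => cost_nonneg hc _ _)
    (Finset.mem_univ i)

end Costs

/-! ### The Equal Cost mechanism -/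

section Mechanism

/-- One index `j` serves `a` for every sample, so the minimum over facilities leaves the integral.
It also has the nearest midpoint, so if any interval contains `a`, the `j`-th does. -/
theorem exists_expCost_eq_potential [NeZero k] (hc : IsConcaveCost c) {ℓ : ℝ} (hℓ : 0 ≤ ℓ)
    {α : Fin k → ℝ} (hsep : ∀ i j, i < j → α i + ℓ < α j) {μ : ProbabilityMeasure ℝ}
    (hμ : (μ : Measure ℝ) (Icc 0 ℓ)ᶜ = 0) {P : ProbabilityMeasure (Fin k → ℝ)}
    (hP : (P : Measure (Fin k → ℝ)) = (μ : Measure ℝ).map (placement ℓ α)) (a : ℝ) :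
    ∃ j, expCost c a P = potential c μ (foldCoord ℓ α j a) ∧
      ((∃ m, a ∈ Icc (α m) (α m + ℓ)) → foldCoord ℓ α j a ∈ Icc 0 ℓ) := by
  obtain ⟨j, hmid, hj⟩ := exists_nearest hℓ hsep a
  refine ⟨j, ?_, ?_⟩
  · rw [expCost, hP, integral_map (continuous_placement ℓ α).aemeasurable
      (continuous_cost hc a).aestronglyMeasurable]
    refine integral_congr_ae ?_
    filter_upwards [measure_eq_zero_iff_ae_notMem.1 hμ] with t ht
    rw [mem_compl_iff, not_not] at ht
    simp only [cost, abs_sub_placement]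
    congr 1
    exact le_antisymm (ciInf_le (finite_range _).bddBelow j) (le_ciInf (hj t ht))
  · rintro ⟨m, hm⟩
    have h := hmid m
    rw [abs_foldCoord_sub_half ℓ α m] at h
    have h2 := abs_le.1 (h.trans (abs_le.2 ⟨by linarith [hm.1], by linarith [hm.2]⟩ :
      |a - (α m + ℓ / 2)| ≤ ℓ / 2))
    exact ⟨by linarith [h2.1], by linarith [h2.2]⟩

/-- Every agent pays the equalized cost. -/
theorem expCost_eq_potential_zero [NeZero k] (hc : IsConcaveCost c) {x : Fin n → ℝ} {ℓ : ℝ}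
    {α : Fin k → ℝ} (hα : IsCovering x ℓ α) {μ : ProbabilityMeasure ℝ} (hμ : IsEqualizing c ℓ μ)
    {P : ProbabilityMeasure (Fin k → ℝ)}
    (hP : (P : Measure (Fin k → ℝ)) = (μ : Measure ℝ).map (placement ℓ α)) (i : Fin n) :
    expCost c (x i) P = potential c μ 0 := by
  obtain ⟨j, hj, hin⟩ := exists_expCost_eq_potential hc hα.length_nonneg
    (fun _ _ h => hα.separated h) hμ.support hP (x i)
  rw [hj, hμ.potential_eq (hin (hα.covers i))]

theorem exists_isEqualCost [NeZero n] [NeZero k] : ∃ F : Mechanism k n, IsEqualCost F := by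
  have h : ∀ (x : Fin n → ℝ) (c : ℝ → ℝ), ∃ P : ProbabilityMeasure (Fin k → ℝ),
      c ∈ concaveCosts → ∃ (ℓ : ℝ) (α : Fin k → ℝ) (μ : ProbabilityMeasure ℝ),
        IsMinLength k x ℓ ∧ IsCovering x ℓ α ∧ IsEqualizing c ℓ μ ∧
          (P : Measure (Fin k → ℝ)) = (μ : Measure ℝ).map (placement ℓ α) := by
    intro x c
    by_cases hc : c ∈ concaveCosts
    · obtain ⟨ℓ, hℓ⟩ := exists_isMinLength (k := k) x
      obtain ⟨α, hα⟩ := hℓ.1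
      obtain ⟨μ, hμ⟩ := exists_isEqualizing hc hα.length_nonneg
      exact ⟨μ.map (continuous_placement ℓ α).aemeasurable, fun _ => ⟨ℓ, α, μ, hℓ, hα, hμ, rfl⟩⟩
    -- For costs outside the class any output is allowed.
    · exact ⟨⟨Measure.dirac 0, inferInstance⟩, fun h => absurd h hc⟩
  choose F hF using h
  exact ⟨F, fun c hc x => hF x c hc⟩

variable {F : Mechanism k n}

theorem IsEqualCost.expCost_le_optMaxCost [NeZero n] [NeZero k] (hF : IsEqualCost F)
    (hc : IsConcaveCost c) (x : Fin n → ℝ) (i : Fin n) :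
    expCost c (x i) (F x c) ≤ optMaxCost k c x := by
  obtain ⟨ℓ, α, μ, hℓ, hα, hμ, hP⟩ := hF c hc x
  rw [optMaxCost_eq hc hℓ, expCost_eq_potential_zero hc hα hμ hP i]
  exact hμ.potential_zero_le_cost_half hc hα.length_nonneg

theorem IsEqualCost.hasSocialCostRatio [NeZero n] [NeZero k] (hF : IsEqualCost F) :
    HasSocialCostRatio concaveCosts F n := by
  intro c hc x
  calc expSocialCost c x (F x c) ≤ ∑ _i : Fin n, optSocialCost k c x :=
        Finset.sum_le_sum fun i _ =>
          (hF.expCost_le_optMaxCost hc x i).trans (optMaxCost_le_optSocialCost hc x)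
    _ = n * optSocialCost k c x := by simp

/-- For every sample in `[0, ℓ]`, each agent has a facility within `ℓ`, in its own interval, and
concavity gives `c ℓ ≤ 2 * c (ℓ / 2)`. -/
theorem IsEqualCost.hasMaxCostRatio [NeZero n] [NeZero k] (hF : IsEqualCost F) :
    HasMaxCostRatio concaveCosts F 2 := by
  intro c hc x
  obtain ⟨ℓ, α, μ, hℓ, hα, hμ, hP⟩ := hF c hc x
  have hcont : Continuous fun t => maxCost c x (placement ℓ α t) :=
    (continuous_maxCost hc x).comp (continuous_placement ℓ α)
  rw [optMaxCost_eq hc hℓ, expMaxCost, hP, integral_map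
    (continuous_placement ℓ α).aemeasurable (continuous_maxCost hc x).aestronglyMeasurable]
  calc ∫ t, maxCost c x (placement ℓ α t) ∂(μ : Measure ℝ)
      ≤ ∫ _, 2 * c (ℓ / 2) ∂(μ : Measure ℝ) := by
        refine integral_mono_ae (integrable_of_compl_Icc_null hμ.support hcont)
          (integrable_const _) ?_
        filter_upwards [measure_eq_zero_iff_ae_notMem.1 hμ.support] with t ht
        rw [mem_compl_iff, not_not] at ht
        refine (ciSup_le fun i => ?_).trans (hc.le_two_mul_half hα.length_nonneg)
        obtain ⟨j, hj⟩ := hα.covers i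
        refine cost_le_of_abs_le hc (j := j) ?_
        unfold placement
        split_ifs
        · exact abs_le.2 ⟨by linarith [hj.1, ht.2], by linarith [hj.2, ht.1]⟩
        · exact abs_le.2 ⟨by linarith [hj.1, ht.1], by linarith [hj.2, ht.2]⟩
    _ = 2 * c (ℓ / 2) := by simp

theorem IsEqualCost.groupStrategyproof [NeZero n] [NeZero k] (hF : IsEqualCost F) :
    GroupStrategyproof concaveCosts F := by
  intro c hc x S hS x' hx'
  obtain ⟨ℓ, α, ν, hℓ, hα, hν, hP⟩ := hF c hc x
  obtain ⟨ℓ', α', μ, hℓ', hα', hμ, hP'⟩ := hF c hc x'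
  have hnn := hα'.length_nonneg
  by_contra! hlt
  simp only [expCost_eq_potential_zero hc hα hν hP] at hlt
  choose J hJ hJin using fun i : Fin n => exists_expCost_eq_potential hc hnn
    (fun _ _ h => hα'.separated h) hμ.support hP' (x i)
  set s : Fin n → ℝ := fun i => foldCoord ℓ' α' (J i) (x i) with hs
  have hzero : potential c μ 0 < potential c ν 0 := by
    obtain ⟨i, hi⟩ := hS
    have h := hlt i hi
    rw [hJ] at h
    exact (hμ.potential_zero_le hc hnn _).trans_lt h
  -- The strict gain extends to truthful agents: they are covered in `x'`, so they pay the constant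
  -- `potential c μ 0`, which no coalition member can undercut.
  have hall : ∀ i, potential c μ (s i) < potential c ν 0 := by
    intro i
    by_cases hi : i ∈ S
    · rw [← hJ]
      exact hlt i hi
    · have h := hα'.covers i
      rw [hx' i hi] at h
      rw [hμ.potential_eq (hJin i h)]
      exact hzero
  obtain ⟨iₗ, hiₗ⟩ := Finite.exists_min s
  obtain ⟨iₕ, hiₕ⟩ := Finite.exists_max s
  have hle : ℓ ≤ max ℓ' (s iₕ) - min 0 (s iₗ) := by
    have h1 := le_max_left ℓ' (s iₕ)
    have h2 := min_le_left 0 (s iₗ)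
    refine hℓ.le_of_cover (by linarith)
      -- These are the preimages of `[lo, hi]`, with `lo = min 0 (s iₗ)` and `hi = max ℓ' (s iₕ)`,
      -- under the folding of each interval; they may overlap.
      (β := fun j => if Even (j : ℕ) then α' j + min 0 (s iₗ) else α' j + ℓ' - max ℓ' (s iₕ))
      fun i => ⟨J i, ?_⟩
    have h3 : min 0 (s iₗ) ≤ s i := (min_le_right _ _).trans (hiₗ i)
    have h4 : s i ≤ max ℓ' (s iₕ) := (hiₕ i).trans (le_max_right _ _)
    have h5 : s i = foldCoord ℓ' α' (J i) (x i) := rfl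
    unfold foldCoord at h5
    split_ifs at h5 ⊢
    · exact ⟨by linarith, by linarith⟩
    · exact ⟨by linarith, by linarith⟩
  have hfin := IsEqualizing.potential_zero_le_max hc hμ hν hα.length_nonneg hnn hle
  refine absurd hfin (not_le.2 (max_lt ?_ ?_))
  · rcases min_choice 0 (s iₗ) with h | h <;> rw [h]
    · exact hzero
    · exact hall _
  · rcases max_choice ℓ' (s iₕ) with h | h <;> rw [h]
    · rw [hμ.potential_eq (right_mem_Icc.2 hnn)]
      exact hzero
    · exact hall _

end Mechanism

end FacilityLocation
end

theorem theorem1 (k n : ℕ) (hk : 1 ≤ k) (hn : k + 1 ≤ n) :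
    (∃ F : FacilityLocation.Mechanism k n, FacilityLocation.IsEqualCost F) ∧
    (∀ F : FacilityLocation.Mechanism k n, FacilityLocation.IsEqualCost F →
      FacilityLocation.GroupStrategyproof FacilityLocation.concaveCosts F ∧
      FacilityLocation.HasMaxCostRatio FacilityLocation.concaveCosts F 2 ∧
      FacilityLocation.HasSocialCostRatio FacilityLocation.concaveCosts F (n : ℝ) ∧
      ∀ c ∈ FacilityLocation.concaveCosts, ∀ (x : Fin n → ℝ) (i : Fin n),
        FacilityLocation.expCost c (x i) (F x c) ≤ FacilityLocation.optMaxCost k c x) ∧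
    (∀ c ∈ FacilityLocation.concaveCosts, ∀ (x : Fin n → ℝ) (ℓ : ℝ),
      FacilityLocation.IsMinLength k x ℓ →
        FacilityLocation.optMaxCost k c x = c (ℓ / 2)) := by
  have : NeZero k := ⟨by omega⟩
  have : NeZero n := ⟨by omega⟩
  exact ⟨FacilityLocation.exists_isEqualCost,
    fun F hF => ⟨hF.groupStrategyproof, hF.hasMaxCostRatio, hF.hasSocialCostRatio,
      fun c hc x i => hF.expCost_le_optMaxCost hc x i⟩,
    fun c hc x ℓ hℓ => FacilityLocation.optMaxCost_eq hc hℓ⟩
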